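/- Let $d$ be a natural number. There is a constant $c>0$, depending only on the dimension $d$, such that the following holds. Let $q:\mathbb{R}^d\times\mathbb{R}^d\to\mathbb{C}$ be a Borel measurable function such that for every $x\in\mathbb{R}^d$ $$q(x,\xi) = -i\,b(x)\cdot\xi+\tfrac12\,\xi\cdot Q(x)\xi+\int_{\mathbb{R}^d\setminus\{0\}}\bigl(1-e^{iy\cdot\xi}+iy\cdot\xi\,\mathbf 1_{(0,1)}(|y|)\bigr)\,\nu(x,dy),\qquad \xi\in\mathbb{R}^d,$$ where $b(x)\in\mathbb{R}^d$, $Q(x)\in\mathbb{R}^{d\times d}$ is symmetric positive semidefinite, and $\nu(x,\cdot)$ is a measure on $\mathbb{R}^d\setminus\{0\}$ with $\int\min\{1,|y|^2\}\,\nu(x,dy)<\infty$ (so $q(x,0)=0$). Let $A$ be the pseudo-differential (Lévy-type) operator with symbol $q$, $$Af(x) = -\int_{\mathbb{R}^d} e^{ix\cdot\xi}\,q(x,\xi)\,\hat f(\xi)\,d\xi,\qquad \hat f(\xi)=(2\pi)^{-d}\int_{\mathbb{R}^d}e^{-ix\cdot\xi}f(x)\,dx,\qquad f\in C_c^\infty(\mathbb{R}^d),$$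 and assume that $Af$ is bounded and Borel measurable for every (real-valued) $f\in C_c^\infty(\mathbb{R}^d)$. Let $\mu$ be a probability measure on $\mathbb{R}^d$ and let $\mathbb{P}^\mu$ be a solution to the $(A,C_c^\infty(\mathbb{R}^d))$-martingale problem with initial distribution $\mu$, i.e. a probability measure on the space $D[0,\infty)$ of càdlàg functions $[0,\infty)\to\mathbb{R}^d$ (with the Borel $\sigma$-algebra of the Skorokhod $J_1$ topology) such that, for the canonical process $X_t(\omega)=\omega(t)$, $\mathbb{P}^\mu(X_0\in\cdot)=\mu$ and $$f(X_t)-f(X_0)-\int_0^t Af(X_s)\,ds,\qquad t\ge 0,$$ is a $\mathbb{P}^\mu$-martingale with respect to the canonical filtration $\mathcal F_t=\sigma(X_s;\,s\le t)$ for every $f\in C_c^\infty(\mathbb{R}^d)$. Then, for all $t>0$ and $R\ge 2r>0$, $$\mathbb{P}^\mu\Bigl(\sup_{s\le t}|X_s|\ge R,\ |X_0|\le r\Bigr)\le c\,t\,\sup_{|y|\le R}\ \sup_{|\xi|\le R^{-1}}|q(y,\xi)|.$$ -/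

import Mathlib

open MeasureTheory ProbabilityTheory Filter Topology Set
open scoped NNReal ENNReal

noncomputable section

namespace LevyType

/-- `ℝ^d` with the Euclidean norm. -/
abbrev Rd (d : ℕ) : Type := EuclideanSpace ℝ (Fin d)

/-! ### Skorokhod space -/

/-- The set `D[0,∞)` of càdlàg functions `[0,∞) → ℝ^d`: right-continuous with finite left-hand
limits. -/
structure SkorokhodSpace (d : ℕ) where
  toFun : ℝ≥0 → Rd d
  rightCts : ∀ t, ContinuousWithinAt toFun (Ici t) t
  leftLim : ∀ t, ∃ l, Tendsto toFun (𝓝[<] t) (𝓝 l)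

namespace SkorokhodSpace

variable {d : ℕ}

/-- The canonical process `X_t(ω) = ω(t)`. -/
def X (t : ℝ≥0) (ω : SkorokhodSpace d) : Rd d := ω.toFun t

/-- Basic neighbourhoods for the Skorokhod (J1) topology. The time changes `lam` are the increasing
bijections of `[0,∞)`. A sequence `y n` is eventually in each `nhd x ε` if and only if there are
time changes `lam n` with `sup_s |lam n s - s| → 0` and `sup_{s ≤ N} |y n (lam n s) - x s| → 0` for
all `N`, which is Skorokhod convergence of `y n` to `x`. -/
def nhd (x : SkorokhodSpace d) (ε : ℝ) : Set (SkorokhodSpace d) :=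
  {y | ∃ lam : ℝ≥0 ≃o ℝ≥0, (∀ s, dist (lam s) s < ε) ∧
    ∀ s : ℝ≥0, (s : ℝ) ≤ 1 / ε → dist (X (lam s) y) (X s x) < ε}

theorem nhd_mono (x : SkorokhodSpace d) {ε δ : ℝ} (hε : 0 < ε) (h : ε ≤ δ) :
    nhd x ε ⊆ nhd x δ := by
  rintro y ⟨lam, h1, h2⟩
  refine ⟨lam, fun s => (h1 s).trans_le h, fun s hs => (h2 s (hs.trans ?_)).trans_le h⟩
  exact one_div_le_one_div_of_le hε h

/-- The Skorokhod (J1) topology on `D[0,∞)`. -/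
instance : TopologicalSpace (SkorokhodSpace d) where
  IsOpen U := ∀ x ∈ U, ∃ ε > 0, nhd x ε ⊆ U
  isOpen_univ := fun _ _ => ⟨1, one_pos, subset_univ _⟩
  isOpen_inter := by
    rintro U V hU hV x ⟨hxU, hxV⟩
    obtain ⟨ε, hε, h1⟩ := hU x hxU
    obtain ⟨δ, hδ, h2⟩ := hV x hxV
    exact ⟨min ε δ, lt_min hε hδ, subset_inter
      ((nhd_mono x (lt_min hε hδ) (min_le_left _ _)).trans h1)
      ((nhd_mono x (lt_min hε hδ) (min_le_right _ _)).trans h2)⟩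
  isOpen_sUnion := by
    rintro S hS x ⟨U, hU, hxU⟩
    obtain ⟨ε, hε, h⟩ := hS U hU x hxU
    exact ⟨ε, hε, h.trans (subset_sUnion_of_mem hU)⟩

theorem isOpen_iff {U : Set (SkorokhodSpace d)} :
    IsOpen U ↔ ∀ x ∈ U, ∃ ε > 0, nhd x ε ⊆ U := Iff.rfl

/-- The Borel σ-algebra of the Skorokhod topology. -/
instance : MeasurableSpace (SkorokhodSpace d) := borel _

instance : BorelSpace (SkorokhodSpace d) := ⟨rfl⟩

theorem isOpen_hits {O : Set (Rd d)} (hO : IsOpen O) (a b : ℝ≥0) :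
    IsOpen {ω : SkorokhodSpace d | ∃ s ∈ Ioo a b, X s ω ∈ O} := by
  rw [isOpen_iff]
  rintro x ⟨s, hs, hx⟩
  obtain ⟨ε₁, h1, hb1⟩ := Metric.isOpen_iff.1 hO _ hx
  obtain ⟨ε₂, h2, hb2⟩ := Metric.isOpen_iff.1 (isOpen_Ioo (a := a) (b := b)) _ hs
  have h3 : (0 : ℝ) < 1 / ((s : ℝ) + 1) := by positivity
  refine ⟨min (min ε₁ ε₂) (1 / ((s : ℝ) + 1)), lt_min (lt_min h1 h2) h3, ?_⟩
  rintro y ⟨lam, hl, hy⟩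
  have hpos : 0 < min (min ε₁ ε₂) (1 / ((s : ℝ) + 1)) := lt_min (lt_min h1 h2) h3
  refine ⟨lam s, hb2 ?_, hb1 ?_⟩
  · exact (hl s).trans_le ((min_le_left _ _).trans (min_le_right _ _))
  · refine (hy s ?_).trans_le ((min_le_left _ _).trans (min_le_left _ _))
    have := one_div_le_one_div_of_le hpos (min_le_right (min ε₁ ε₂) (1 / ((s : ℝ) + 1)))
    rw [one_div_one_div] at this
    linarith

theorem measurable_X (t : ℝ≥0) : Measurable (X t : SkorokhodSpace d → Rd d) := by
  refine measurable_of_isClosed fun F hF => ?_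
  have key : (X t : SkorokhodSpace d → Rd d) ⁻¹' F =
      ⋂ k : ℕ, ⋂ n : ℕ, {ω | ∃ s ∈ Ioo t (t + 1 / ((n : ℝ≥0) + 1)),
        X s ω ∈ Metric.thickening (1 / ((k : ℝ) + 1)) F} := by
    ext ω
    have hrc : Tendsto (fun s => X s ω) (𝓝[>] t) (𝓝 (X t ω)) :=
      (ω.rightCts t).mono_left (nhdsWithin_mono _ Ioi_subset_Ici_self)
    simp only [mem_preimage, mem_iInter, mem_ofPred_eq]
    constructor
    · intro h k n
      have hk : (0 : ℝ) < 1 / ((k : ℝ) + 1) := by positivity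
      have hn : t < t + 1 / ((n : ℝ≥0) + 1) := lt_add_of_pos_right _ (by positivity)
      have e1 := hrc.eventually (Metric.isOpen_thickening.mem_nhds
        (Metric.self_subset_thickening hk F h))
      exact ((eventually_of_mem (Ioo_mem_nhdsGT hn) fun _ hs => hs).and e1).exists
    · intro h
      by_contra hx
      obtain ⟨ε, hε, hb⟩ := Metric.isOpen_iff.1 hF.isOpen_compl _ hx
      obtain ⟨k, hk⟩ := exists_nat_one_div_lt (half_pos hε)
      have e1 : ∀ᶠ s in 𝓝[>] t, dist (X s ω) (X t ω) < ε / 2 :=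
        hrc.eventually (Metric.ball_mem_nhds _ (half_pos hε))
      obtain ⟨u, hu, hu'⟩ := (mem_nhdsGT_iff_exists_Ioo_subset' (lt_add_one t)).1 e1
      have hu0 : (0 : ℝ) < (u : ℝ) - t := sub_pos.2 (NNReal.coe_lt_coe.2 hu)
      obtain ⟨n, hn⟩ := exists_nat_one_div_lt hu0
      obtain ⟨s, hs, hsF⟩ := h k n
      have hsu : s < u := by
        rw [← NNReal.coe_lt_coe]
        have := NNReal.coe_lt_coe.2 hs.2
        push_cast at this
        linarith
      have hd : dist (X s ω) (X t ω) < ε / 2 := hu' ⟨hs.1, hsu⟩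
      obtain ⟨z, hzF, hz⟩ := Metric.mem_thickening_iff.1 hsF
      refine hb ?_ hzF
      rw [Metric.mem_ball]
      have := dist_triangle_left z (X t ω) (X s ω)
      linarith
  rw [key]
  exact MeasurableSet.iInter fun k => MeasurableSet.iInter fun n =>
    (isOpen_hits Metric.isOpen_thickening _ _).measurableSet

/-- The canonical filtration `ℱ_t = σ(X_s; s ≤ t)`. -/
def canonicalFiltration (d : ℕ) :
    Filtration ℝ≥0 (inferInstance : MeasurableSpace (SkorokhodSpace d)) :=
  Filtration.natural X fun t => (measurable_X t).stronglyMeasurable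

end SkorokhodSpace

/-! ### Martingale problems -/

/-- `P` is a solution to the `(A, D)`-martingale problem with initial distribution `μ`: it is a
probability measure on `D[0,∞)` with `P(X_0 ∈ ·) = μ`, and for all `u ∈ D` the process
`u(X_t) - u(X_0) - ∫_0^t A u(X_s) ds` is a `P`-martingale for the canonical filtration. Only the
restriction of `A` to `D` matters. -/
structure IsMartingaleSolution {d : ℕ} (A : (Rd d → ℝ) → Rd d → ℝ) (D : Set (Rd d → ℝ))
    (μ : Measure (Rd d)) (P : Measure (SkorokhodSpace d)) : Prop where
  isProbabilityMeasure : IsProbabilityMeasure P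
  initial : P.map (SkorokhodSpace.X 0) = μ
  martingale : ∀ u ∈ D, Martingale
    (fun (t : ℝ≥0) ω => u (SkorokhodSpace.X t ω) - u (SkorokhodSpace.X 0 ω)
      - ∫ s in (0 : ℝ)..t, A u (SkorokhodSpace.X s.toNNReal ω))
    (SkorokhodSpace.canonicalFiltration d) P

/-! ### Lévy-type operators -/

/-- A Lévy triplet `(b, Q, ν)`. The Lévy measure on `ℝ^d \ {0}` is given as a measure on `ℝ^d`
without mass at `0`; the integrability condition makes it σ-finite. -/
structure LevyTriplet (d : ℕ) where
  b : Rd d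
  Q : Matrix (Fin d) (Fin d) ℝ
  ν : Measure (Rd d)
  posSemidef : Q.PosSemidef
  zero : ν {0} = 0
  integrable : ∫⁻ y, ENNReal.ofReal (min 1 (‖y‖ ^ 2)) ∂ν < ∞

/-- The continuous negative definite function vanishing at `0` given by the Lévy–Khintchine formula
`-i b·ξ + ½ ξ·Qξ + ∫ (1 - e^{i y·ξ} + i y·ξ 1_{(0,1)}(|y|)) ν(dy)`. -/
def LevyTriplet.exponent {d : ℕ} (T : LevyTriplet d) (ξ : Rd d) : ℂ :=
  -Complex.I * (inner ℝ T.b ξ : ℝ)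
    + (1 / 2 : ℂ) * ((ξ.ofLp ⬝ᵥ (T.Q.mulVec ξ.ofLp) : ℝ) : ℂ)
    + ∫ y, (1 - Complex.exp (Complex.I * (inner ℝ y ξ : ℝ))
        + Complex.I * (inner ℝ y ξ : ℝ) * ((Ioo (0 : ℝ) 1).indicator 1 ‖y‖ : ℂ)) ∂T.ν

/-- `q` is the symbol of a Lévy-type operator with `q(x,0) = 0`: it is jointly Borel measurable, and
`q(x,·)` has a Lévy–Khintchine representation for every `x`. -/
structure IsLevySymbol {d : ℕ} (q : Rd d → Rd d → ℂ) : Prop where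
  measurable : Measurable (Function.uncurry q)
  exists_triplet : ∀ x, ∃ T : LevyTriplet d, ∀ ξ, q x ξ = T.exponent ξ

/-- The space `C_c^∞(ℝ^d)` of real-valued test functions. -/
def testFunctions (d : ℕ) : Set (Rd d → ℝ) :=
  {f | ContDiff ℝ ((⊤ : ℕ∞) : WithTop ℕ∞) f ∧ HasCompactSupport f}

/-- The space `ℬ_b(ℝ^d)` of bounded Borel measurable functions. -/
def boundedBorel (d : ℕ) : Set (Rd d → ℝ) :=
  {f | Measurable f ∧ ∃ C, ∀ x, |f x| ≤ C}

/-- The Fourier transform `(2π)^{-d} ∫ e^{-i x·ξ} f(x) dx`. -/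
def fourierHat {d : ℕ} (f : Rd d → ℝ) (ξ : Rd d) : ℂ :=
  (((2 * Real.pi) ^ d)⁻¹ : ℝ) * ∫ x, Complex.exp (-Complex.I * (inner ℝ x ξ : ℝ)) * (f x : ℂ)

/-- `A` is on `C_c^∞(ℝ^d)` the pseudo-differential operator `-q(x,D)` with symbol `q`, that is
`A f(x) = -∫ e^{i x·ξ} q(x,ξ) f̂(ξ) dξ`. -/
def IsPseudoDifferentialOperator {d : ℕ} (A : (Rd d → ℝ) → Rd d → ℝ) (q : Rd d → Rd d → ℂ) : Prop :=
  ∀ f ∈ testFunctions d, ∀ x, (A f x : ℂ) =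
    -∫ ξ, Complex.exp (Complex.I * (inner ℝ x ξ : ℝ)) * q x ξ * fourierHat f ξ

end LevyType

end

namespace LevyType

/-! ### Growth of the symbol -/

/-! Test the martingale problem with a smooth cutoff `u` at scale `R`, equal to 1 for `|x| ≤ R/2`
and to 0 for `|x| ≥ 3R/4`. For paths started in the ball of radius `r`, optional stopping at the
exit from the ball of radius `3R/4` bounds the exit probability by `t` times the supremum of `|A u|`
over that ball: before the exit the path sees no other values of `A u`.

To bound `A u`, the symbol has to be controlled at all frequencies by its supremum `S` over `|ξ| ≤
1/R`. A Lévy exponent satisfies `|ψ(2ξ)| ≤ 4|ψ(ξ)|` (`norm_exponent_two_smul_le`), and iteration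
gives `|ψ(ξ)| ≤ 4S(1 + |Rξ|²)`. The integral of `1 + |Rξ|²` against the modulus of the transform of
`u` does not depend on `R`, so `|A u| ≤ 4S` times a constant of the dimension
(`enorm_operator_cutoff_le`).

Stopping is done on finite time grids (`measure_exit_grid_le`). A path may exit unseen between grid
points, but by right-continuity fine grids overlook at most one such time
(`subsingleton_missed_exits`). The reverse Fatou lemma, dominated by the global bound of `A u`, then
yields the estimate in the limit (`measure_exists_exceeds_le`). -/

theorem norm_one_sub_exp_sq (θ : ℝ) :
    ‖1 - Complex.exp (Complex.I * θ)‖ ^ 2 = 2 * (1 - Real.cos θ) := by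
  have h : 1 - Complex.exp (Complex.I * θ) =
      ((1 - Real.cos θ : ℝ) : ℂ) + ((-Real.sin θ : ℝ) : ℂ) * Complex.I := by
    rw [mul_comm, Complex.exp_mul_I]
    push_cast
    ring
  rw [h, ← Complex.normSq_eq_norm_sq, Complex.normSq_add_mul_I]
  nlinarith [Real.sin_sq_add_cos_sq θ]

theorem norm_one_sub_exp_le (θ : ℝ) : ‖1 - Complex.exp (Complex.I * θ)‖ ≤ |θ| := by
  rw [norm_sub_rev]
  exact Real.norm_exp_I_mul_ofReal_sub_one_le

theorem norm_one_sub_exp_le_two (θ : ℝ) : ‖1 - Complex.exp (Complex.I * θ)‖ ≤ 2 := by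
  refine (norm_sub_le _ _).trans ?_
  rw [mul_comm, Complex.norm_exp_ofReal_mul_I, norm_one]
  norm_num

theorem norm_one_sub_exp_add_le (θ : ℝ) :
    ‖1 - Complex.exp (Complex.I * θ) + Complex.I * θ‖ ≤ 2 * θ ^ 2 := by
  have hn : ‖Complex.I * (θ : ℂ)‖ = |θ| := by simp
  rcases le_total |θ| 1 with h | h
  · have h1 := Complex.norm_exp_sub_one_sub_id_le (x := Complex.I * θ) (hn.trans_le h)
    rw [hn, sq_abs] at h1
    have h2 : 1 - Complex.exp (Complex.I * θ) + Complex.I * θ =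
        -(Complex.exp (Complex.I * θ) - 1 - Complex.I * θ) := by ring
    rw [h2, norm_neg]
    nlinarith [sq_nonneg θ]
  · have h1 := norm_add_le (1 - Complex.exp (Complex.I * θ)) (Complex.I * θ)
    rw [hn] at h1
    have h2 := norm_one_sub_exp_le θ
    nlinarith [sq_abs θ]

namespace LevyTriplet

variable {d : ℕ} (T : LevyTriplet d)

/-- The integrand of the Lévy–Khintchine formula. -/
noncomputable def jumpIntegrand (ξ y : Rd d) : ℂ :=
  1 - Complex.exp (Complex.I * (inner ℝ y ξ : ℝ))
    + Complex.I * (inner ℝ y ξ : ℝ) * ((Ioo (0 : ℝ) 1).indicator 1 ‖y‖ : ℂ)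

theorem measurable_jumpIntegrand (ξ : Rd d) : Measurable (jumpIntegrand ξ) := by
  have hi : Measurable fun y : Rd d => ((inner ℝ y ξ : ℝ) : ℂ) := by fun_prop
  refine ((measurable_const.sub (hi.const_mul _).cexp)).add ((hi.const_mul _).mul ?_)
  exact (measurable_one.indicator measurableSet_Ioo).comp measurable_norm

theorem integrable_min : Integrable (fun y => min 1 (‖y‖ ^ 2)) T.ν := by
  refine ⟨by fun_prop, ?_⟩
  rw [hasFiniteIntegral_iff_ofReal (ae_of_all _ fun y => by positivity)]
  exact T.integrable

theorem inner_sq_le (ξ y : Rd d) : (inner ℝ y ξ : ℝ) ^ 2 ≤ ‖ξ‖ ^ 2 * ‖y‖ ^ 2 := by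
  rw [← sq_abs, ← mul_pow]
  exact pow_le_pow_left₀ (abs_nonneg _) ((abs_real_inner_le_norm y ξ).trans_eq (mul_comm _ _)) 2

theorem integrable_jumpIntegrand (ξ : Rd d) : Integrable (jumpIntegrand ξ) T.ν := by
  refine (T.integrable_min.const_mul (2 * ‖ξ‖ ^ 2 + 2)).mono'
    (measurable_jumpIntegrand ξ).aestronglyMeasurable (ae_of_all _ fun y => ?_)
  have hξ := sq_nonneg ‖ξ‖
  have hy := sq_nonneg ‖y‖
  rcases lt_or_ge ‖y‖ 1 with h | h
  · have hm : min 1 (‖y‖ ^ 2) = ‖y‖ ^ 2 := min_eq_right (pow_le_one₀ (norm_nonneg _) h.le)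
    have h1 : jumpIntegrand ξ y = 1 - Complex.exp (Complex.I * (inner ℝ y ξ : ℝ))
        + Complex.I * (inner ℝ y ξ : ℝ) := by
      -- The interval `Ioo 0 1` leaves out `y = 0`, where the compensating term vanishes anyway.
      rcases eq_or_ne y 0 with rfl | h0
      · simp [jumpIntegrand]
      · have : ‖y‖ ∈ Ioo (0 : ℝ) 1 := ⟨norm_pos_iff.2 h0, h⟩
        simp [jumpIntegrand, indicator_of_mem this]
    rw [h1, hm]
    have h2 := norm_one_sub_exp_add_le (inner ℝ y ξ)
    have h3 := inner_sq_le ξ y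
    nlinarith
  · have hm : min 1 (‖y‖ ^ 2) = 1 := min_eq_left (one_le_pow₀ h)
    have h1 : jumpIntegrand ξ y = 1 - Complex.exp (Complex.I * (inner ℝ y ξ : ℝ)) := by
      have : ‖y‖ ∉ Ioo (0 : ℝ) 1 := fun h' => h'.2.not_ge h
      simp [jumpIntegrand, indicator_of_notMem this]
    rw [h1, hm]
    have h2 := norm_one_sub_exp_le_two (inner ℝ y ξ)
    nlinarith

theorem integrable_norm_one_sub_exp_sq (ξ : Rd d) :
    Integrable (fun y => ‖1 - Complex.exp (Complex.I * (inner ℝ y ξ : ℝ))‖ ^ 2) T.ν := by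
  refine (T.integrable_min.const_mul (‖ξ‖ ^ 2 + 4)).mono'
    (by fun_prop) (ae_of_all _ fun y => ?_)
  have h0 := norm_nonneg (1 - Complex.exp (Complex.I * (inner ℝ y ξ : ℝ)))
  have h1 := norm_one_sub_exp_le (inner ℝ y ξ)
  have h2 := norm_one_sub_exp_le_two (inner ℝ y ξ)
  have h3 := inner_sq_le ξ y
  have h4 : ‖1 - Complex.exp (Complex.I * (inner ℝ y ξ : ℝ))‖ ^ 2 ≤ ‖ξ‖ ^ 2 * ‖y‖ ^ 2 := by
    refine le_trans ?_ h3
    rw [← sq_abs (inner ℝ y ξ)]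
    exact pow_le_pow_left₀ h0 h1 2
  rw [Real.norm_of_nonneg (by positivity)]
  have hξ := sq_nonneg ‖ξ‖
  have hy := sq_nonneg ‖y‖
  rcases le_total 1 (‖y‖ ^ 2) with h | h
  · rw [min_eq_left h]
    nlinarith
  · rw [min_eq_right h]
    nlinarith

/-- The compensator is purely imaginary, so the integrand has real part `1 - cos`, which is half the
squared modulus. -/
theorem integral_norm_one_sub_exp_sq (ξ : Rd d) :
    ∫ y, ‖1 - Complex.exp (Complex.I * (inner ℝ y ξ : ℝ))‖ ^ 2 ∂T.ν
      = 2 * (∫ y, jumpIntegrand ξ y ∂T.ν).re := by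
  have h := integral_re (𝕜 := ℂ) (T.integrable_jumpIntegrand ξ)
  simp only [RCLike.re_eq_complex_re] at h
  rw [← h, ← integral_const_mul]
  congr 1
  ext y
  rw [norm_one_sub_exp_sq, jumpIntegrand, mul_comm Complex.I, Complex.exp_mul_I,
    ← Complex.ofReal_cos, ← Complex.ofReal_sin]
  by_cases hy : ‖y‖ ∈ Ioo (0 : ℝ) 1
  · simp [indicator_of_mem hy, -Complex.ofReal_cos]
  · simp [indicator_of_notMem hy, -Complex.ofReal_cos]

theorem exponent_eq (ξ : Rd d) : T.exponent ξ = -Complex.I * (inner ℝ T.b ξ : ℝ)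
    + (1 / 2 : ℂ) * ((ξ.ofLp ⬝ᵥ (T.Q.mulVec ξ.ofLp) : ℝ) : ℂ) + ∫ y, jumpIntegrand ξ y ∂T.ν := rfl

theorem re_exponent (ξ : Rd d) : 2 * (T.exponent ξ).re =
    (ξ.ofLp ⬝ᵥ (T.Q.mulVec ξ.ofLp)) +
      ∫ y, ‖1 - Complex.exp (Complex.I * (inner ℝ y ξ : ℝ))‖ ^ 2 ∂T.ν := by
  rw [integral_norm_one_sub_exp_sq, exponent_eq]
  have : (1 / 2 : ℂ) = ((1 / 2 : ℝ) : ℂ) := by push_cast; rfl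
  rw [this, Complex.add_re, Complex.add_re, Complex.re_ofReal_mul, Complex.ofReal_re, neg_mul,
    Complex.neg_re, Complex.re_mul_ofReal, Complex.I_re]
  ring

/-- With `z = e^{i y·ξ}` one has `1 - z² = 2(1 - z) - (1 - z)²`; drift and compensator are linear in
`ξ`, and the quadratic part is multiplied by 4 rather than 2. -/
theorem exponent_two_smul (ξ : Rd d) : T.exponent ((2 : ℝ) • ξ) = 2 * T.exponent ξ
    + ((ξ.ofLp ⬝ᵥ (T.Q.mulVec ξ.ofLp) : ℝ) : ℂ)
    - ∫ y, (1 - Complex.exp (Complex.I * (inner ℝ y ξ : ℝ))) ^ 2 ∂T.ν := by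
  have hsq : Integrable (fun y => (1 - Complex.exp (Complex.I * (inner ℝ y ξ : ℝ))) ^ 2) T.ν := by
    refine (T.integrable_norm_one_sub_exp_sq ξ).mono' (by fun_prop) (ae_of_all _ fun y => ?_)
    rw [norm_pow]
  have hj : ∫ y, jumpIntegrand ((2 : ℝ) • ξ) y ∂T.ν = 2 * ∫ y, jumpIntegrand ξ y ∂T.ν
      - ∫ y, (1 - Complex.exp (Complex.I * (inner ℝ y ξ : ℝ))) ^ 2 ∂T.ν := by
    rw [← integral_const_mul, ← integral_sub ((T.integrable_jumpIntegrand ξ).const_mul 2) hsq]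
    congr 1
    ext y
    have he : Complex.exp (Complex.I * ((2 * inner ℝ y ξ : ℝ) : ℂ)) =
        Complex.exp (Complex.I * (inner ℝ y ξ : ℝ)) ^ 2 := by
      rw [← Complex.exp_nat_mul]
      push_cast
      ring_nf
    rw [jumpIntegrand, jumpIntegrand, real_inner_smul_right, he]
    push_cast
    ring
  rw [exponent_eq, exponent_eq, hj, real_inner_smul_right, WithLp.ofLp_smul, Matrix.mulVec_smul,
    smul_dotProduct, dotProduct_smul, smul_eq_mul, smul_eq_mul]
  push_cast
  ring

/-- By `re_exponent`, the two corrections in the doubling formula have moduli adding up to at most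
`2 Re ψ(ξ) ≤ 2|ψ(ξ)|`. The factor 4 is what makes the iterated growth quadratic. -/
theorem norm_exponent_two_smul_le (ξ : Rd d) :
    ‖T.exponent ((2 : ℝ) • ξ)‖ ≤ 4 * ‖T.exponent ξ‖ := by
  have hQ : 0 ≤ ξ.ofLp ⬝ᵥ (T.Q.mulVec ξ.ofLp) := by
    simpa using T.posSemidef.dotProduct_mulVec_nonneg ξ.ofLp
  rw [exponent_two_smul]
  have h1 : ‖∫ y, (1 - Complex.exp (Complex.I * (inner ℝ y ξ : ℝ))) ^ 2 ∂T.ν‖ ≤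
      ∫ y, ‖1 - Complex.exp (Complex.I * (inner ℝ y ξ : ℝ))‖ ^ 2 ∂T.ν := by
    refine (norm_integral_le_integral_norm _).trans_eq ?_
    simp only [norm_pow]
  have h2 := T.re_exponent ξ
  have h3 := Complex.re_le_norm (T.exponent ξ)
  refine (norm_sub_le _ _).trans ?_
  have h4 := norm_add_le (2 * T.exponent ξ) ((ξ.ofLp ⬝ᵥ (T.Q.mulVec ξ.ofLp) : ℝ) : ℂ)
  rw [norm_mul, Complex.norm_real, Real.norm_of_nonneg hQ, Complex.norm_ofNat] at h4
  linarith

theorem norm_exponent_two_pow_smul_le (n : ℕ) (ξ : Rd d) :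
    ‖T.exponent ((2 : ℝ) ^ n • ξ)‖ ≤ 4 ^ n * ‖T.exponent ξ‖ := by
  induction n with
  | zero => simp
  | succ n ih =>
    rw [pow_succ', mul_smul, pow_succ']
    refine (T.norm_exponent_two_smul_le _).trans ?_
    linarith

/-- A bound of the exponent on the ball of radius `R⁻¹` yields quadratic growth on `ℝ^d`. -/
theorem norm_exponent_le {R S : ℝ} (hR : 0 < R) (hS : ∀ ξ, ‖ξ‖ ≤ R⁻¹ → ‖T.exponent ξ‖ ≤ S)
    (ξ : Rd d) : ‖T.exponent ξ‖ ≤ 4 * S * (1 + ‖R • ξ‖ ^ 2) := by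
  have hS0 : 0 ≤ S := (norm_nonneg _).trans (hS 0 (by simpa using hR.le))
  have hn : ‖R • ξ‖ = R * ‖ξ‖ := by rw [norm_smul, Real.norm_of_nonneg hR.le]
  rcases le_or_gt ‖R • ξ‖ 1 with h | h
  · have h1 := hS ξ (by rw [hn] at h; rwa [← one_div, le_div_iff₀' hR])
    nlinarith [mul_nonneg hS0 (sq_nonneg ‖R • ξ‖)]
  -- With `2^n ≤ |Rξ| < 2^(n+1)`, the point `2^{-(n+1)} ξ` lies in the ball of radius `R⁻¹`.
  -- Doubling it `n + 1` times costs `4^(n+1) ≤ 4|Rξ|²`.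
  · obtain ⟨n, hn1, hn2⟩ := exists_nat_pow_near h.le (one_lt_two (α := ℝ))
    have h1 := T.norm_exponent_two_pow_smul_le (n + 1) (((2 : ℝ) ^ (n + 1))⁻¹ • ξ)
    rw [smul_inv_smul₀ (by positivity)] at h1
    have h2 := hS (((2 : ℝ) ^ (n + 1))⁻¹ • ξ) (by
      rw [norm_smul, norm_inv, norm_pow, Real.norm_ofNat, inv_mul_le_iff₀ (by positivity),
        ← div_eq_mul_inv, le_div_iff₀ hR, mul_comm, ← hn]
      exact hn2.le)
    have h3 : (4 : ℝ) ^ n ≤ ‖R • ξ‖ ^ 2 := by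
      calc (4 : ℝ) ^ n = (2 ^ n) ^ 2 := by rw [← pow_mul, mul_comm, pow_mul]; norm_num
        _ ≤ _ := pow_le_pow_left₀ (by positivity) hn1 2
    have h4 := h1.trans (mul_le_mul_of_nonneg_left h2 (by positivity))
    rw [pow_succ] at h4
    nlinarith [mul_le_mul_of_nonneg_right h3 hS0]

end LevyTriplet

end LevyType

namespace LevyType

/-! ### The cutoff function -/

open scoped FourierTransform

/-- A smooth cutoff function, equal to `1` for `‖x‖ ≤ 1 / 2` and to `0` for `3 / 4 ≤ ‖x‖`. -/
noncomputable def bump (d : ℕ) : ContDiffBump (0 : Rd d) where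
  rIn := 1 / 2
  rOut := 3 / 4
  rIn_pos := by norm_num
  rIn_lt_rOut := by norm_num

/-- The cutoff function at scale `R`. -/
noncomputable def cutoff (d : ℕ) (R : ℝ) (x : Rd d) : ℝ := bump d (R⁻¹ • x)

variable {d : ℕ} {R : ℝ}

theorem norm_inv_smul_eq (hR : 0 < R) (x : Rd d) : ‖R⁻¹ • x‖ = ‖x‖ / R := by
  rw [norm_smul, norm_inv, Real.norm_of_nonneg hR.le, inv_mul_eq_div]

theorem cutoff_eq_one (hR : 0 < R) {x : Rd d} (hx : 2 * ‖x‖ ≤ R) : cutoff d R x = 1 := by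
  refine (bump d).one_of_mem_closedBall ?_
  rw [mem_closedBall_zero_iff, norm_inv_smul_eq hR, div_le_iff₀ hR]
  change ‖x‖ ≤ 1 / 2 * R
  linarith

theorem cutoff_eq_zero (hR : 0 < R) {x : Rd d} (hx : 3 / 4 * R ≤ ‖x‖) : cutoff d R x = 0 := by
  refine (bump d).zero_of_le_dist ?_
  rw [dist_zero_right, norm_inv_smul_eq hR, le_div_iff₀ hR]
  exact hx

theorem cutoff_mem_testFunctions (hR : 0 < R) : cutoff d R ∈ testFunctions d := by
  refine ⟨(bump d).contDiff.comp (contDiff_const_smul _), ?_⟩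
  refine HasCompactSupport.of_support_subset_isCompact (isCompact_closedBall (0 : Rd d) R) ?_
  intro x hx
  rw [mem_closedBall_zero_iff]
  by_contra! h
  exact hx (cutoff_eq_zero hR (by linarith))

/-! ### Scaling and decay of the Fourier transform of the cutoff -/

theorem fourierHat_cutoff (hR : 0 < R) (ξ : Rd d) :
    fourierHat (cutoff d R) ξ = ((R ^ d : ℝ) : ℂ) * fourierHat (bump d) (R • ξ) := by
  have h := Measure.integral_comp_inv_smul (volume : Measure (Rd d))
    (fun x => Complex.exp (-Complex.I * (inner ℝ x (R • ξ) : ℝ)) * (bump d x : ℂ)) R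
  rw [finrank_euclideanSpace_fin, abs_of_pos (by positivity), Complex.real_smul] at h
  rw [fourierHat, fourierHat, mul_left_comm, ← h]
  congr 2
  ext x
  rw [real_inner_smul_left, real_inner_smul_right, inv_mul_cancel_left₀ hR.ne', cutoff]

theorem fourierHat_eq_fourier (f : Rd d → ℝ) (ξ : Rd d) : fourierHat f ξ =
    (((2 * Real.pi) ^ d)⁻¹ : ℝ) * 𝓕 (fun x => (f x : ℂ)) ((2 * Real.pi)⁻¹ • ξ) := by
  rw [fourierHat, Real.fourier_eq']
  congr 2
  ext x
  have : (-2 * Real.pi * inner ℝ x ((2 * Real.pi)⁻¹ • ξ) : ℝ) = - inner ℝ x ξ := by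
    rw [real_inner_smul_right]
    field_simp
  rw [this, smul_eq_mul]
  push_cast
  ring_nf

/-- The transform of a test function is a Schwartz function. The weight `(2π)²` in the proof offsets
the change of frequency variable between the two normalizations. -/
theorem integrable_one_add_sq_mul_fourierHat {f : Rd d → ℝ} (hf : f ∈ testFunctions d) :
    Integrable fun ξ => (1 + ‖ξ‖ ^ 2) * ‖fourierHat f ξ‖ := by
  have h1 : HasCompactSupport fun x => (f x : ℂ) :=
    hf.2.comp_left (g := fun t : ℝ => (t : ℂ)) Complex.ofReal_zero
  have h2 : ContDiff ℝ ((⊤ : ℕ∞) : WithTop ℕ∞) fun x => (f x : ℂ) :=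
    Complex.ofRealCLM.contDiff.comp hf.1
  set F := 𝓕 (h1.toSchwartzMap h2)
  have hF : (F : Rd d → ℂ) = 𝓕 (fun x => (f x : ℂ)) := by
    rw [SchwartzMap.fourier_coe]
    rfl
  have h3 := ((F.integrable (μ := volume)).norm.add
    ((F.integrable_pow_mul volume 2).const_mul ((2 * Real.pi) ^ 2))).comp_smul
      (R := (2 * Real.pi)⁻¹) (by positivity)
  refine (h3.const_mul (((2 * Real.pi) ^ d)⁻¹)).congr (ae_of_all _ fun ξ => ?_)
  simp only [Pi.add_apply]
  rw [fourierHat_eq_fourier, ← hF, norm_mul, Complex.norm_real,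
    Real.norm_of_nonneg (by positivity), norm_smul, Real.norm_of_nonneg (by positivity)]
  field_simp

/-- The second moment `∫ (1 + ‖ξ‖²) |û(ξ)| dξ` of the cutoff function. -/
noncomputable def bumpMoment (d : ℕ) : ℝ≥0∞ :=
  ∫⁻ ξ : Rd d, ENNReal.ofReal ((1 + ‖ξ‖ ^ 2) * ‖fourierHat (bump d) ξ‖)

theorem bumpMoment_ne_top (d : ℕ) : bumpMoment d ≠ ∞ :=
  ((hasFiniteIntegral_iff_ofReal (ae_of_all _ fun ξ => by positivity)).1
    (integrable_one_add_sq_mul_fourierHat (f := bump d)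
      ⟨(bump d).contDiff, (bump d).hasCompactSupport⟩).2).ne

/-- The substitution `η = Rξ` absorbs the factor `R^d`; this is why the final constant depends on
the dimension only. -/
theorem lintegral_scaled_fourierHat (hR : 0 < R) :
    ∫⁻ ξ : Rd d, ENNReal.ofReal ((1 + ‖R • ξ‖ ^ 2) * ‖fourierHat (cutoff d R) ξ‖)
      = bumpMoment d := by
  have he : (fun ξ : Rd d => ENNReal.ofReal ((1 + ‖R • ξ‖ ^ 2) * ‖fourierHat (cutoff d R) ξ‖)) =
      fun ξ => ENNReal.ofReal (R ^ d) * (fun η : Rd d =>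
        ENNReal.ofReal ((1 + ‖η‖ ^ 2) * ‖fourierHat (bump d) η‖)) (R • ξ) := by
    ext ξ
    rw [fourierHat_cutoff hR, norm_mul, Complex.norm_real, Real.norm_of_nonneg (by positivity),
      ← ENNReal.ofReal_mul (by positivity)]
    congr 1
    ring
  have hm := (Homeomorph.smulOfNeZero R hR.ne' : Rd d ≃ₜ Rd d).measurableEmbedding.lintegral_map
    (μ := volume) (fun η : Rd d => ENNReal.ofReal ((1 + ‖η‖ ^ 2) * ‖fourierHat (bump d) η‖))
  have hm' : Measure.map (Homeomorph.smulOfNeZero R hR.ne' : Rd d ≃ₜ Rd d) volume =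
      ENNReal.ofReal |(R ^ d)⁻¹| • (volume : Measure (Rd d)) := by
    have := Measure.map_addHaar_smul (volume : Measure (Rd d)) hR.ne'
    rwa [finrank_euclideanSpace_fin] at this
  rw [hm', lintegral_smul_measure] at hm
  rw [he, lintegral_const_mul' _ _ ENNReal.ofReal_ne_top]
  refine (congrArg _ hm.symm).trans ?_
  rw [smul_eq_mul, ← mul_assoc, ← ENNReal.ofReal_mul (by positivity), abs_of_pos (by positivity),
    mul_inv_cancel₀ (by positivity), ENNReal.ofReal_one, one_mul, bumpMoment]

theorem enorm_operator_cutoff_le {q : Rd d → Rd d → ℂ} {A : (Rd d → ℝ) → Rd d → ℝ}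
    (hq : IsLevySymbol q) (hA : IsPseudoDifferentialOperator A q) (hR : 0 < R) {S : ℝ} {x : Rd d}
    (hS : ∀ ξ, ‖ξ‖ ≤ R⁻¹ → ‖q x ξ‖ ≤ S) :
    ‖A (cutoff d R) x‖ₑ ≤ ENNReal.ofReal (4 * S) * bumpMoment d := by
  have hS0 : 0 ≤ S := (norm_nonneg _).trans (hS 0 (by simpa using hR.le))
  obtain ⟨T, hT⟩ := hq.exists_triplet x
  have h1 : ‖A (cutoff d R) x‖ₑ = ‖(A (cutoff d R) x : ℂ)‖ₑ := by
    rw [← ofReal_norm, ← ofReal_norm, Complex.norm_real]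
  rw [h1, hA _ (cutoff_mem_testFunctions hR), enorm_neg, ← lintegral_scaled_fourierHat hR,
    ← lintegral_const_mul' _ _ ENNReal.ofReal_ne_top]
  refine (enorm_integral_le_lintegral_enorm _).trans (lintegral_mono fun ξ => ?_)
  rw [← ofReal_norm, ← ENNReal.ofReal_mul (by positivity), norm_mul, norm_mul,
    mul_comm Complex.I, Complex.norm_exp_ofReal_mul_I, one_mul, ← mul_assoc]
  refine ENNReal.ofReal_le_ofReal (mul_le_mul_of_nonneg_right ?_ (norm_nonneg _))
  rw [hT]
  exact T.norm_exponent_le hR (fun η hη => hT η ▸ hS η hη) ξ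

end LevyType

namespace LevyType

open SkorokhodSpace

variable {d : ℕ}

/-! ### Paths and time grids -/

/-- The time grid with mesh `t / (n + 1)`. -/
noncomputable def grid (t : ℝ≥0) (n j : ℕ) : ℝ≥0 := j * (t / (n + 1))

theorem grid_mono (t : ℝ≥0) (n : ℕ) : Monotone (grid t n) := fun i j h => by
  unfold grid
  gcongr

theorem grid_zero (t : ℝ≥0) (n : ℕ) : grid t n 0 = 0 := by simp [grid]

theorem grid_last (t : ℝ≥0) (n : ℕ) : grid t n (n + 1) = t := by
  unfold grid
  push_cast
  field_simp

theorem lt_grid_floor_succ {t : ℝ≥0} (ht : 0 < t) (n : ℕ) (s : ℝ≥0) :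
    s < grid t n (⌊s / (t / (n + 1))⌋₊ + 1) := by
  have h : 0 < t / ((n : ℝ≥0) + 1) := by positivity
  unfold grid
  rw [← div_lt_iff₀ h]
  exact_mod_cast Nat.lt_floor_add_one _

theorem grid_floor_succ_le {t : ℝ≥0} (ht : 0 < t) (n : ℕ) (s : ℝ≥0) :
    grid t n (⌊s / (t / (n + 1))⌋₊ + 1) ≤ s + t / (n + 1) := by
  have h : 0 < t / ((n : ℝ≥0) + 1) := by positivity
  unfold grid
  push_cast
  rw [add_one_mul]
  gcongr
  exact (le_div_iff₀ h).1 (Nat.floor_le zero_le)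

theorem tendsto_mesh (t : ℝ≥0) : Tendsto (fun n : ℕ => t / ((n : ℝ≥0) + 1)) atTop (𝓝 0) := by
  rw [← NNReal.tendsto_coe]
  simpa [div_eq_mul_inv] using
    (tendsto_one_div_add_atTop_nhds_zero_nat (𝕜 := ℝ)).const_mul (t : ℝ)

theorem tendsto_grid_floor_succ {t : ℝ≥0} (ht : 0 < t) (s : ℝ≥0) :
    Tendsto (fun n : ℕ => grid t n (⌊s / (t / (n + 1))⌋₊ + 1)) atTop (𝓝[>] s) := by
  refine tendsto_nhdsWithin_iff.2 ⟨?_, Eventually.of_forall fun n => lt_grid_floor_succ ht n s⟩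
  refine tendsto_of_tendsto_of_tendsto_of_le_of_le tendsto_const_nhds
    (by simpa using (tendsto_mesh t).const_add s) (fun n => (lt_grid_floor_succ ht n s).le)
    fun n => grid_floor_succ_le ht n s

/-- Evaluating the path at the next grid point strictly to the right gives step functions that
converge pointwise by right-continuity. -/
theorem measurable_path (ω : SkorokhodSpace d) : Measurable fun s => X s ω := by
  refine measurable_of_tendsto_metrizable
    (f := fun (n : ℕ) s => X (grid 1 n (⌊s / (1 / ((n : ℝ≥0) + 1))⌋₊ + 1)) ω) (fun n => ?_)
    (tendsto_pi_nhds.2 fun s => ?_)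
  · exact (measurable_from_top (f := fun k : ℕ => X (grid 1 n (k + 1)) ω)).comp
      (Nat.measurable_floor.comp (measurable_id.div_const _))
  · exact ((ω.rightCts s).mono_left (nhdsWithin_mono _ Ioi_subset_Ici_self)).comp
      (tendsto_grid_floor_succ one_pos s)

/-- The strict inequality persists just to the right of `s`, where every sufficiently fine grid has
a point. -/
theorem eventually_exists_grid_exceeds {t : ℝ≥0} (ht : 0 < t) {ω : SkorokhodSpace d} {ρ : ℝ}
    {s v : ℝ≥0} (hsv : s < v) (hs : ρ < ‖X s ω‖) :
    ∀ᶠ n in atTop, ∃ j, grid t n j < v ∧ ρ < ‖X (grid t n j) ω‖ := by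
  have h1 : ∀ᶠ u in 𝓝[>] s, ρ < ‖X u ω‖ :=
    ((ω.rightCts s).mono_left (nhdsWithin_mono _ Ioi_subset_Ici_self)).norm.eventually
      (lt_mem_nhds hs)
  have h2 : ∀ᶠ u in 𝓝[>] s, u < v := (eventually_lt_nhds hsv).filter_mono nhdsWithin_le_nhds
  filter_upwards [(tendsto_grid_floor_succ ht s).eventually (h1.and h2)] with n hn
  exact ⟨_, hn.2, hn.1⟩

/-! ### The stopped martingale on a time grid -/

/-- The event that the path starts in the ball of radius `r` and stays in the ball of radius `ρ`
at the times `τ 0, …, τ k`. -/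
def staysIn (d : ℕ) (r ρ : ℝ) (τ : ℕ → ℝ≥0) (k : ℕ) : Set (SkorokhodSpace d) :=
  {ω | ‖X 0 ω‖ ≤ r ∧ ∀ j ≤ k, ‖X (τ j) ω‖ ≤ ρ}

/-- The additive functional `∫_0^t f(X_s) ds`. -/
noncomputable def occupation (f : Rd d → ℝ) (t : ℝ≥0) (ω : SkorokhodSpace d) : ℝ :=
  ∫ s in (0 : ℝ)..t, f (X s.toNNReal ω)

/-- The additive functional up to the exit time on the grid. -/
noncomputable def stoppedOccupation (f : Rd d → ℝ) (r ρ : ℝ) (τ : ℕ → ℝ≥0) (N : ℕ)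
    (ω : SkorokhodSpace d) : ℝ :=
  ∑ k ∈ Finset.range N, (staysIn d r ρ τ k).indicator
    (fun ω => occupation f (τ (k + 1)) ω - occupation f (τ k) ω) ω

section exit

variable {u f : Rd d → ℝ} {r ρ : ℝ} {τ : ℕ → ℝ≥0} {P : Measure (SkorokhodSpace d)}

theorem measurableSet_staysIn (hτ : Monotone τ) (k : ℕ) :
    MeasurableSet[canonicalFiltration d (τ k)] (staysIn d r ρ τ k) := by
  have hX : ∀ s ≤ τ k, Measurable[canonicalFiltration d (τ k)] (X s) := fun s hs =>
    ((Filtration.stronglyAdapted_natural fun t => (measurable_X (d := d) t).stronglyMeasurable)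
      s |>.measurable).mono ((canonicalFiltration d).mono hs) le_rfl
  have h : staysIn d r ρ τ k = X 0 ⁻¹' {x | ‖x‖ ≤ r} ∩ ⋂ j ∈ {j | j ≤ k},
      X (τ j) ⁻¹' {x | ‖x‖ ≤ ρ} := by
    ext ω
    simp [staysIn]
  rw [h]
  refine MeasurableSet.inter (hX 0 (zero_le) (measurableSet_le measurable_norm measurable_const))
    (MeasurableSet.biInter (to_countable _) fun j hj =>
      hX _ (hτ hj) (measurableSet_le measurable_norm measurable_const))

/-- Read off from the adapted martingale, whose other terms are measurable; joint measurability in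
time and path is not needed. -/
theorem measurable_occupation (hu : Continuous u) (hM : Martingale
    (fun (t : ℝ≥0) ω => u (X t ω) - u (X 0 ω) - occupation f t ω) (canonicalFiltration d) P)
    (t : ℝ≥0) : Measurable (occupation (d := d) f t) := by
  have h1 := ((hM.1 t).mono ((canonicalFiltration d).le t)).measurable
  have h2 := ((hu.measurable.comp (measurable_X t)).sub (hu.measurable.comp (measurable_X 0))).sub h1
  have he : occupation f t = u ∘ X t - u ∘ X 0 -
      (fun ω : SkorokhodSpace d => u (X t ω) - u (X 0 ω) - occupation f t ω) := by
    ext ω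
    simp
  rw [he]
  exact h2

theorem measurable_stoppedOccupation (hτ : Monotone τ) (hu : Continuous u) (hM : Martingale
    (fun (t : ℝ≥0) ω => u (X t ω) - u (X 0 ω) - occupation f t ω) (canonicalFiltration d) P)
    (N : ℕ) : Measurable (stoppedOccupation f r ρ τ N) := by
  unfold stoppedOccupation
  exact Finset.measurable_sum _ fun k _ => ((measurable_occupation hu hM _).sub
    (measurable_occupation hu hM _)).indicator
      ((canonicalFiltration d).le _ _ (measurableSet_staysIn hτ k))

/-- A path that first leaves the ball at `τ (k + 1)` contributes nothing, because `u` vanishes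
there. This makes the stopped sum telescope. -/
theorem indicator_staysIn_step (hu0 : ∀ x, ρ < ‖x‖ → u x = 0) (k : ℕ) (ω : SkorokhodSpace d) :
    (staysIn d r ρ τ k).indicator (fun ω => u (X (τ (k + 1)) ω)) ω =
      (staysIn d r ρ τ (k + 1)).indicator (fun ω => u (X (τ (k + 1)) ω)) ω := by
  by_cases h : ω ∈ staysIn d r ρ τ k
  · by_cases h' : ω ∈ staysIn d r ρ τ (k + 1)
    · rw [indicator_of_mem h, indicator_of_mem h']
    · rw [indicator_of_mem h, indicator_of_notMem h']
      refine hu0 _ (not_le.1 fun hle => h' ⟨h.1, fun j hj => ?_⟩)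
      rcases Nat.le_succ_iff.1 hj with hj | rfl
      exacts [h.2 j hj, hle]
  · have h' : ω ∉ staysIn d r ρ τ (k + 1) := fun h' =>
      h ⟨h'.1, fun j hj => h'.2 j (hj.trans k.le_succ)⟩
    rw [indicator_of_notMem h, indicator_of_notMem h']

theorem sum_indicator_staysIn_increments (hu0 : ∀ x, ρ < ‖x‖ → u x = 0) (N : ℕ)
    (ω : SkorokhodSpace d) :
    ∑ k ∈ Finset.range N, (staysIn d r ρ τ k).indicator
        (fun ω => (u (X (τ (k + 1)) ω) - u (X 0 ω) - occupation f (τ (k + 1)) ω)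
          - (u (X (τ k) ω) - u (X 0 ω) - occupation f (τ k) ω)) ω =
      (staysIn d r ρ τ N).indicator (fun ω => u (X (τ N) ω)) ω
        - (staysIn d r ρ τ 0).indicator (fun ω => u (X (τ 0) ω)) ω
        - stoppedOccupation f r ρ τ N ω := by
  induction N with
  | zero => simp [stoppedOccupation]
  | succ N ih =>
    rw [Finset.sum_range_succ, ih, ← indicator_staysIn_step hu0, stoppedOccupation,
      stoppedOccupation, Finset.sum_range_succ]
    by_cases h : ω ∈ staysIn d r ρ τ N
    · simp only [indicator_of_mem h]
      ring
    · simp only [indicator_of_notMem h]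
      ring

/-- Optional stopping on a time grid: the probability to leave the ball of radius `ρ` is controlled
by the additive functional up to the exit time. -/
theorem measure_exit_grid_le [IsProbabilityMeasure P] (hτ : Monotone τ) (hτ0 : τ 0 = 0) (hrρ : r ≤ ρ)
    (hu : Continuous u) (huc : HasCompactSupport u)
    (hu0 : ∀ x, ρ < ‖x‖ → u x = 0) (hu1 : ∀ x, ‖x‖ ≤ r → u x = 1) (hle : ∀ x, u x ≤ 1)
    (hM : Martingale (fun (t : ℝ≥0) ω => u (X t ω) - u (X 0 ω) - occupation f t ω)
      (canonicalFiltration d) P) (N : ℕ) :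
    P {ω | ‖X 0 ω‖ ≤ r ∧ ∃ j ≤ N, ρ < ‖X (τ j) ω‖} ≤
      ∫⁻ ω, ‖stoppedOccupation f r ρ τ N ω‖ₑ ∂P := by
  have hB : ∀ k, MeasurableSet (staysIn d r ρ τ k) := fun k =>
    (canonicalFiltration d).le _ _ (measurableSet_staysIn hτ k)
  have hui : ∀ s, Integrable (fun ω => u (X s ω)) P := fun s => by
    obtain ⟨C, hC⟩ := hu.bounded_above_of_compact_support huc
    exact Integrable.of_bound (hu.measurable.comp (measurable_X s)).aestronglyMeasurable C
      (ae_of_all _ fun ω => hC _)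
  set M := fun (t : ℝ≥0) ω => u (X t ω) - u (X 0 ω) - occupation f t ω
  set Z := fun ω => ∑ k ∈ Finset.range N, (staysIn d r ρ τ k).indicator
    (fun ω => M (τ (k + 1)) ω - M (τ k) ω) ω
  have hMi : ∀ k, Integrable (fun ω => (staysIn d r ρ τ k).indicator
      (fun ω => M (τ (k + 1)) ω - M (τ k) ω) ω) P := fun k =>
    ((hM.integrable _).sub (hM.integrable _)).indicator (hB k)
  have hZi : Integrable Z P := integrable_finsetSum _ fun k _ => hMi k
  -- `Z` is a martingale transform: each increment is restricted to an event known at its left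
  -- endpoint `τ k`.
  have hZ0 : ∫ ω, Z ω ∂P = 0 := by
    rw [integral_finsetSum _ fun k _ => hMi k]
    refine Finset.sum_eq_zero fun k _ => ?_
    rw [integral_indicator (hB k), integral_sub (hM.integrable _).integrableOn
      (hM.integrable _).integrableOn, sub_eq_zero]
    exact (hM.setIntegral_eq (hτ k.le_succ) (measurableSet_staysIn hτ k)).symm
  set b := fun ω => (staysIn d r ρ τ N).indicator (fun ω => u (X (τ N) ω)) ω
        - (staysIn d r ρ τ 0).indicator (fun ω => u (X (τ 0) ω)) ω
  have hbi : Integrable b P := ((hui _).indicator (hB _)).sub ((hui _).indicator (hB _))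
  have hZ : ∀ ω, Z ω = b ω - stoppedOccupation f r ρ τ N ω := fun ω =>
    sum_indicator_staysIn_increments hu0 N ω
  have hHi : Integrable (stoppedOccupation f r ρ τ N) P := by
    refine (hbi.sub hZi).congr (ae_of_all _ fun ω => ?_)
    rw [Pi.sub_apply, hZ, sub_sub_cancel]
  set E := {ω : SkorokhodSpace d | ‖X 0 ω‖ ≤ r ∧ ∃ j ≤ N, ρ < ‖X (τ j) ω‖}
  have hE : MeasurableSet E := by
    have : E = X 0 ⁻¹' {x | ‖x‖ ≤ r} \ staysIn d r ρ τ N := by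
      ext ω
      simp only [E, staysIn, mem_ofPred_eq, Set.mem_sdiff, mem_preimage, not_and, not_forall, not_le]
      grind
    rw [this]
    exact (measurable_X 0 (measurableSet_le measurable_norm measurable_const)).diff (hB N)
  -- For a start in the small ball, `-b` is 1 minus the value of `u` at the end if the path was
  -- never seen outside: it equals 1 on `E` and is nonnegative otherwise.
  have hEb : ∀ ω, E.indicator 1 ω ≤ - b ω := fun ω => by
    have h0 : ω ∈ staysIn d r ρ τ 0 ↔ ‖X 0 ω‖ ≤ r := by
      refine ⟨fun h => h.1, fun h => ⟨h, fun j hj => ?_⟩⟩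
      rw [Nat.le_zero.1 hj, hτ0]
      exact h.trans hrρ
    by_cases hr : ‖X 0 ω‖ ≤ r
    · have hb : b ω = (staysIn d r ρ τ N).indicator (fun ω => u (X (τ N) ω)) ω - 1 := by
        simp only [b, indicator_of_mem (h0.2 hr), hτ0, hu1 _ hr]
      by_cases hN : ω ∈ staysIn d r ρ τ N
      · have hEn : ω ∉ E := fun ⟨_, j, hj, h⟩ => (hN.2 j hj).not_gt h
        rw [hb, indicator_of_mem hN, indicator_of_notMem hEn]
        linarith [hle (X (τ N) ω)]
      · rw [hb, indicator_of_notMem hN]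
        refine (indicator_le_self' (fun _ _ => zero_le_one) ω).trans ?_
        simp
    · have hN : ω ∉ staysIn d r ρ τ N := fun h => hr h.1
      have hEn : ω ∉ E := fun h => hr h.1
      simp only [b, indicator_of_notMem hN, indicator_of_notMem hEn,
        indicator_of_notMem fun h => hr (h0.1 h), sub_zero, neg_zero, le_refl]
  have h1 : P.real E ≤ ‖∫ ω, stoppedOccupation f r ρ τ N ω ∂P‖ := by
    have h2 : ∫ ω, b ω ∂P = ∫ ω, stoppedOccupation f r ρ τ N ω ∂P := by
      have h3 : ∫ ω, Z ω ∂P = ∫ ω, b ω ∂P - ∫ ω, stoppedOccupation f r ρ τ N ω ∂P := by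
        rw [← integral_sub hbi hHi]
        exact integral_congr_ae (ae_of_all _ hZ)
      linarith
    rw [← integral_indicator_one hE, ← h2, ← norm_neg, ← integral_neg]
    exact (integral_mono ((integrable_const (1 : ℝ)).indicator hE) hbi.neg hEb).trans
      (le_abs_self _)
  rw [← ENNReal.ofReal_toReal (measure_ne_top P E)]
  refine (ENNReal.ofReal_le_ofReal h1).trans ?_
  rw [ofReal_norm]
  exact enorm_integral_le_lintegral_enorm _

end exit

end LevyType

namespace LevyType

open SkorokhodSpace

variable {d : ℕ}

/-! ### The additive functional up to the exit time -/

section pathwise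

variable {f : Rd d → ℝ} {r ρ C : ℝ} {t : ℝ≥0}

theorem measurable_comp_path (hf : Measurable f) (ω : SkorokhodSpace d) :
    Measurable fun s : ℝ => f (X s.toNNReal ω) :=
  hf.comp ((measurable_path ω).comp measurable_real_toNNReal)

theorem intervalIntegrable_comp_path (hf : Measurable f) (hC : ∀ x, |f x| ≤ C)
    (ω : SkorokhodSpace d) (a b : ℝ) :
    IntervalIntegrable (fun s : ℝ => f (X s.toNNReal ω)) volume a b :=
  (intervalIntegrable_const (c := C)).mono_fun' (measurable_comp_path hf ω).aestronglyMeasurable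
    (ae_of_all _ fun _ => hC _)

theorem enorm_occupation_sub_le (hf : Measurable f) (hC : ∀ x, |f x| ≤ C) (ω : SkorokhodSpace d)
    {a b : ℝ≥0} (hab : a ≤ b) : ‖occupation f b ω - occupation f a ω‖ₑ ≤
      ∫⁻ s in Ico (a : ℝ) b, ‖f (X s.toNNReal ω)‖ₑ := by
  rw [occupation, occupation, intervalIntegral.integral_interval_sub_left
    (intervalIntegrable_comp_path hf hC ω _ _) (intervalIntegrable_comp_path hf hC ω _ _),
    intervalIntegral.integral_of_le (NNReal.coe_le_coe.2 hab), ← integral_Ico_eq_integral_Ioc]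
  exact enorm_integral_le_lintegral_enorm _

/-- The times at which the path has not yet left the ball of radius `ρ` on the time grid. -/
def survivalTimes (r ρ : ℝ) (t : ℝ≥0) (n : ℕ) (ω : SkorokhodSpace d) : Set ℝ :=
  {s | ω ∈ staysIn d r ρ (grid t n) ⌊s.toNNReal / (t / (n + 1))⌋₊}

theorem measurableSet_survivalTimes (n : ℕ) (ω : SkorokhodSpace d) :
    MeasurableSet (survivalTimes r ρ t n ω) :=
  (Nat.measurable_floor.comp (measurable_real_toNNReal.div_const _))
    (MeasurableSet.of_discrete (s := {k | ω ∈ staysIn d r ρ (grid t n) k}))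

theorem floor_eq_of_mem_Ico_grid (ht : 0 < t) {n k : ℕ} {s : ℝ}
    (hs : s ∈ Ico (grid t n k : ℝ) (grid t n (k + 1))) :
    ⌊s.toNNReal / (t / (n + 1))⌋₊ = k := by
  have h : 0 < t / ((n : ℝ≥0) + 1) := by positivity
  rw [Nat.floor_eq_iff zero_le, le_div_iff₀ h, div_lt_iff₀ h]
  refine ⟨NNReal.le_toNNReal_of_coe_le hs.1, ?_⟩
  have := (Real.toNNReal_lt_iff_lt_coe ((NNReal.coe_nonneg _).trans hs.1)).2 hs.2
  simpa [grid] using this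

/-- On the `k`-th left-closed grid cell the floor index is `k`, so survival is constant there and
the sum over cells becomes one integral. -/
theorem enorm_stoppedOccupation_le (hf : Measurable f) (hC : ∀ x, |f x| ≤ C) (ht : 0 < t)
    (ω : SkorokhodSpace d) (n : ℕ) :
    ‖stoppedOccupation f r ρ (grid t n) (n + 1) ω‖ₑ ≤
      ∫⁻ s in Ico (0 : ℝ) t, (survivalTimes r ρ t n ω).indicator
        (fun s => ‖f (X s.toNNReal ω)‖ₑ) s := by
  suffices h : ∀ N, ‖stoppedOccupation f r ρ (grid t n) N ω‖ₑ ≤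
      ∫⁻ s in Ico (0 : ℝ) (grid t n N), (survivalTimes r ρ t n ω).indicator
        (fun s => ‖f (X s.toNNReal ω)‖ₑ) s by
    simpa only [grid_last] using h (n + 1)
  intro N
  induction N with
  | zero => simp [stoppedOccupation]
  | succ N ih =>
    have hN := NNReal.coe_le_coe.2 (grid_mono t n N.le_succ)
    rw [stoppedOccupation, Finset.sum_range_succ, ← Ico_union_Ico_eq_Ico
      (NNReal.coe_nonneg (grid t n N)) hN, lintegral_union measurableSet_Ico
      (Ico_disjoint_Ico_same ..)]
    refine (enorm_add_le _ _).trans (add_le_add ih ?_)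
    by_cases h : ω ∈ staysIn d r ρ (grid t n) N
    · rw [indicator_of_mem h]
      refine (enorm_occupation_sub_le hf hC ω (grid_mono t n N.le_succ)).trans_eq ?_
      refine setLIntegral_congr_fun measurableSet_Ico fun s hs => ?_
      have : s ∈ survivalTimes r ρ t n ω := by
        rw [survivalTimes, mem_ofPred_eq, floor_eq_of_mem_Ico_grid ht hs]
        exact h
      simp only [indicator_of_mem this]
    · rw [indicator_of_notMem h, enorm_zero]
      exact bot_le

/-- At most one point of the path beyond the ball of radius `ρ` is missed by the grids. -/
theorem subsingleton_missed_exits (ht : 0 < t) (ω : SkorokhodSpace d) :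
    {s : ℝ | 0 ≤ s ∧ ρ < ‖X s.toNNReal ω‖ ∧
      ∃ᶠ n in atTop, s ∈ survivalTimes r ρ t n ω}.Subsingleton := by
  -- An excursion at `s₁` is detected by all fine grids strictly before `s₂`, so `s₂` eventually
  -- stops being a survival time.
  have key : ∀ s₁ s₂ : ℝ, 0 ≤ s₁ → s₁ < s₂ → ρ < ‖X s₁.toNNReal ω‖ →
      ¬ ∃ᶠ n in atTop, s₂ ∈ survivalTimes r ρ t n ω := by
    intro s₁ s₂ h0 h12 hρ
    rw [not_frequently]
    have h12' := (Real.toNNReal_lt_toNNReal_iff (h0.trans_lt h12)).2 h12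
    filter_upwards [eventually_exists_grid_exceeds ht h12' hρ] with n ⟨j, hj, hjρ⟩ hs
    have h : 0 < t / ((n : ℝ≥0) + 1) := by positivity
    refine (hs.2 j (Nat.le_floor ?_)).not_gt hjρ
    rw [le_div_iff₀ h]
    exact hj.le
  rintro s₁ ⟨h1, h1ρ, h1f⟩ s₂ ⟨h2, h2ρ, h2f⟩
  rcases lt_trichotomy s₁ s₂ with h | h | h
  exacts [(key s₁ s₂ h1 h h1ρ h2f).elim, h, (key s₂ s₁ h2 h h2ρ h1f).elim]

theorem lintegral_Ico_const_coe (c : ℝ≥0∞) (t : ℝ≥0) :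
    ∫⁻ _ in Ico (0 : ℝ) t, c = c * t := by
  rw [setLIntegral_const, Real.volume_Ico, sub_zero, ENNReal.ofReal_coe_nnreal]

theorem enorm_le_ofReal_of_abs_le (hC : ∀ x, |f x| ≤ C) (x : Rd d) :
    ‖f x‖ₑ ≤ ENNReal.ofReal C := by
  rw [← ofReal_norm]
  exact ENNReal.ofReal_le_ofReal (hC x)

theorem enorm_stoppedOccupation_le_const (hf : Measurable f) (hC : ∀ x, |f x| ≤ C) (ht : 0 < t)
    (ω : SkorokhodSpace d) (n : ℕ) :
    ‖stoppedOccupation f r ρ (grid t n) (n + 1) ω‖ₑ ≤ ENNReal.ofReal C * t := by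
  refine (enorm_stoppedOccupation_le hf hC ht ω n).trans ?_
  rw [← lintegral_Ico_const_coe]
  exact lintegral_mono fun s => (indicator_le_self _ _ s).trans (enorm_le_ofReal_of_abs_le hC _)

/-- Reverse Fatou in time: apart from one point, each time either has its path value in the ball,
where `K` applies, or eventually drops out of the survival set. The bound `C` only dominates and
leaves no trace in the result. -/
theorem limsup_enorm_stoppedOccupation_le (hf : Measurable f) (hC : ∀ x, |f x| ≤ C) (ht : 0 < t)
    {K : ℝ≥0∞} (hK : ∀ x, ‖x‖ ≤ ρ → ‖f x‖ₑ ≤ K) (ω : SkorokhodSpace d) :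
    limsup (fun n => ‖stoppedOccupation f r ρ (grid t n) (n + 1) ω‖ₑ) atTop ≤ K * t := by
  have hfm := (measurable_comp_path hf ω).enorm
  calc limsup (fun n => ‖stoppedOccupation f r ρ (grid t n) (n + 1) ω‖ₑ) atTop
      ≤ limsup (fun n => ∫⁻ s in Ico (0 : ℝ) t, (survivalTimes r ρ t n ω).indicator
        (fun s => ‖f (X s.toNNReal ω)‖ₑ) s) atTop :=
        limsup_le_limsup (Eventually.of_forall fun n => enorm_stoppedOccupation_le hf hC ht ω n)
    _ ≤ ∫⁻ s in Ico (0 : ℝ) t, limsup (fun n => (survivalTimes r ρ t n ω).indicator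
        (fun s => ‖f (X s.toNNReal ω)‖ₑ) s) atTop := by
        refine limsup_lintegral_le (fun _ => ENNReal.ofReal C)
          (fun n => hfm.indicator (measurableSet_survivalTimes n ω))
          (fun n => ae_of_all _ fun s => (indicator_le_self _ _ s).trans
            (enorm_le_ofReal_of_abs_le hC _)) ?_
        rw [lintegral_Ico_const_coe]
        exact ENNReal.mul_ne_top ENNReal.ofReal_ne_top ENNReal.coe_ne_top
    _ ≤ ∫⁻ _ in Ico (0 : ℝ) t, K := by
        refine lintegral_mono_ae ?_
        have hnull := (subsingleton_missed_exits (r := r) (ρ := ρ) ht ω).measure_zero volume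
        filter_upwards [ae_restrict_mem measurableSet_Ico,
          ae_restrict_of_ae (measure_eq_zero_iff_ae_notMem.1 hnull)] with s hs hs'
        refine limsup_le_of_le (h := ?_)
        by_cases hρ : ‖X s.toNNReal ω‖ ≤ ρ
        · exact Eventually.of_forall fun n => (indicator_le_self _ _ s).trans (hK _ hρ)
        · have : ∀ᶠ n in atTop, s ∉ survivalTimes r ρ t n ω :=
            not_frequently.1 fun h => hs' ⟨hs.1, not_le.1 hρ, h⟩
          filter_upwards [this] with n hn
          rw [indicator_of_notMem hn]
          exact zero_le
    _ = K * t := lintegral_Ico_const_coe K t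

end pathwise

/-- A maximal inequality: the probability to leave the ball of radius `ρ` before time `t`. -/
theorem measure_exists_exceeds_le {u f : Rd d → ℝ} {r ρ C : ℝ} {t : ℝ≥0}
    {P : Measure (SkorokhodSpace d)} [IsProbabilityMeasure P] (hrρ : r ≤ ρ) (ht : 0 < t)
    (hu : Continuous u) (huc : HasCompactSupport u)
    (hu0 : ∀ x, ρ < ‖x‖ → u x = 0) (hu1 : ∀ x, ‖x‖ ≤ r → u x = 1) (hle : ∀ x, u x ≤ 1)
    (hf : Measurable f) (hC : ∀ x, |f x| ≤ C) {K : ℝ≥0∞} (hK : ∀ x, ‖x‖ ≤ ρ → ‖f x‖ₑ ≤ K)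
    (hM : Martingale (fun (t : ℝ≥0) ω => u (X t ω) - u (X 0 ω) - occupation f t ω)
      (canonicalFiltration d) P) :
    P {ω | ‖X 0 ω‖ ≤ r ∧ ∃ s ≤ t, ρ < ‖X s ω‖} ≤ K * t := by
  set E := fun n : ℕ => {ω : SkorokhodSpace d | ‖X 0 ω‖ ≤ r ∧ ∃ j ≤ n + 1, ρ < ‖X (grid t n j) ω‖}
  set H := fun (n : ℕ) (ω : SkorokhodSpace d) =>
    ‖stoppedOccupation f r ρ (grid t n) (n + 1) ω‖ₑ
  -- The grids are not nested, so the limit inferior of the events `E n` takes the place of an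
  -- increasing union.
  have hsub : {ω | ‖X 0 ω‖ ≤ r ∧ ∃ s ≤ t, ρ < ‖X s ω‖} ⊆ ⋃ m, ⋂ n ≥ m, E n := by
    rintro ω ⟨h0, s, hst, hs⟩
    suffices h : ∀ᶠ n in atTop, ω ∈ E n by simpa using h
    rcases hst.eq_or_lt with rfl | hst
    -- There is no room to the right of `s = t`, but `t` belongs to every grid.
    · exact Eventually.of_forall fun n => ⟨h0, n + 1, le_rfl, by rwa [grid_last]⟩
    · filter_upwards [eventually_exists_grid_exceeds ht hst hs] with n ⟨j, hj, hjρ⟩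
      refine ⟨h0, j, not_lt.1 fun hlt => hj.not_ge ?_, hjρ⟩
      exact (grid_last t n).symm.le.trans (grid_mono t n hlt.le)
  have hlim : limsup (fun n => ∫⁻ ω, H n ω ∂P) atTop ≤ K * t := by
    refine (limsup_lintegral_le (fun _ => ENNReal.ofReal C * t)
      (fun n => (measurable_stoppedOccupation (grid_mono t n) hu hM _).enorm)
      (fun n => ae_of_all _ fun ω => enorm_stoppedOccupation_le_const hf hC ht ω n) ?_).trans ?_
    · rw [lintegral_const, measure_univ, mul_one]
      exact ENNReal.mul_ne_top ENNReal.ofReal_ne_top ENNReal.coe_ne_top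
    · refine (lintegral_mono fun ω => limsup_enorm_stoppedOccupation_le hf hC ht hK ω).trans_eq ?_
      rw [lintegral_const, measure_univ, mul_one]
  refine (measure_mono hsub).trans ?_
  have hmono : Monotone fun m => ⋂ n ≥ m, E n := fun a b hab =>
    biInter_subset_biInter_left fun n hn => hab.trans hn
  rw [hmono.measure_iUnion]
  refine iSup_le fun m => le_trans ?_ hlim
  refine le_limsup_of_frequently_le (Eventually.frequently ?_)
  filter_upwards [eventually_ge_atTop m] with n hn
  exact (measure_mono (biInter_subset_of_mem hn)).trans
    (measure_exit_grid_le (grid_mono t n) (grid_zero t n) hrρ hu huc hu0 hu1 hle hM _)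

end LevyType

/-! ### The maximal inequality in terms of the symbol -/

theorem proposition2p7 (d : ℕ) :
    ∃ c : ℝ, 0 < c ∧
      ∀ (q : LevyType.Rd d → LevyType.Rd d → ℂ)
        (A : (LevyType.Rd d → ℝ) → LevyType.Rd d → ℝ)
        (μ : Measure (LevyType.Rd d)) (P : Measure (LevyType.SkorokhodSpace d)),
        LevyType.IsLevySymbol q →
        LevyType.IsPseudoDifferentialOperator A q →
        (∀ f ∈ LevyType.testFunctions d, A f ∈ LevyType.boundedBorel d) →
        IsProbabilityMeasure μ →
        LevyType.IsMartingaleSolution A (LevyType.testFunctions d) μ P →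
        ∀ (t : ℝ≥0) (r R : ℝ), 0 < t → 0 < r → 2 * r ≤ R →
          P {ω | ENNReal.ofReal R ≤ (⨆ s : ℝ≥0, ⨆ _ : s ≤ t, ‖LevyType.SkorokhodSpace.X s ω‖ₑ) ∧
                ‖LevyType.SkorokhodSpace.X 0 ω‖ ≤ r}
            ≤ ENNReal.ofReal c * t *
              ⨆ y : LevyType.Rd d, ⨆ _ : ‖y‖ ≤ R, ⨆ ξ : LevyType.Rd d, ⨆ _ : ‖ξ‖ ≤ R⁻¹, ‖q y ξ‖ₑ := by
  -- The summand 1 only secures positivity.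
  refine ⟨4 * (LevyType.bumpMoment d).toReal + 1, by positivity, ?_⟩
  intro q A μ P hq hA hAb _ hP t r R ht hr hrR
  have := hP.isProbabilityMeasure
  have hR : 0 < R := by linarith
  set S := ⨆ y : LevyType.Rd d, ⨆ _ : ‖y‖ ≤ R, ⨆ ξ : LevyType.Rd d, ⨆ _ : ‖ξ‖ ≤ R⁻¹, ‖q y ξ‖ₑ
  rcases eq_or_ne S ∞ with hS | hS
  · rw [hS, ENNReal.mul_top]
    · exact le_top
    · exact mul_ne_zero (ENNReal.ofReal_pos.2 (by positivity)).ne' (ENNReal.coe_pos.2 ht).ne'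
  have hqS : ∀ y, ‖y‖ ≤ R → ∀ ξ, ‖ξ‖ ≤ R⁻¹ → ‖q y ξ‖ ≤ S.toReal := fun y hy ξ hξ => by
    rw [← toReal_enorm]
    exact ENNReal.toReal_mono hS (le_iSup₂_of_le y hy (le_iSup₂_of_le ξ hξ le_rfl))
  set u := LevyType.cutoff d R
  have hu : u ∈ LevyType.testFunctions d := LevyType.cutoff_mem_testFunctions hR
  obtain ⟨hf, C, hC⟩ := hAb u hu
  -- A supremum of at least `R` need not be attained, but it forces a time with norm above `3R/4 <
  -- R`, where the cutoff already vanishes.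
  have key := LevyType.measure_exists_exceeds_le (P := P) (u := u) (r := r) (ρ := 3 / 4 * R)
    (by linarith) ht hu.1.continuous hu.2 (fun x hx => LevyType.cutoff_eq_zero hR hx.le)
    (fun x hx => LevyType.cutoff_eq_one hR (by linarith)) (fun x => (LevyType.bump d).le_one)
    hf hC (fun x hx => LevyType.enorm_operator_cutoff_le hq hA hR (hqS x (by linarith)))
    (hP.martingale u hu)
  refine (measure_mono ?_).trans (key.trans ?_)
  · rintro ω ⟨h1, h2⟩
    have h3 : ENNReal.ofReal (3 / 4 * R) < ENNReal.ofReal R :=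
      (ENNReal.ofReal_lt_ofReal_iff hR).2 (by linarith)
    obtain ⟨s, hs⟩ := lt_iSup_iff.1 (h3.trans_le h1)
    obtain ⟨hst, hs⟩ := lt_iSup_iff.1 hs
    rw [← ofReal_norm, ENNReal.ofReal_lt_ofReal_iff_of_nonneg (by positivity)] at hs
    exact ⟨h2, s, hst, hs⟩
  · have h4 : ENNReal.ofReal (4 * S.toReal) * LevyType.bumpMoment d ≤
        ENNReal.ofReal (4 * (LevyType.bumpMoment d).toReal + 1) * S := by
      calc ENNReal.ofReal (4 * S.toReal) * LevyType.bumpMoment d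
          = ENNReal.ofReal (4 * S.toReal * (LevyType.bumpMoment d).toReal) := by
            rw [ENNReal.ofReal_mul (p := 4 * S.toReal) (by positivity),
              ENNReal.ofReal_toReal (LevyType.bumpMoment_ne_top d)]
        _ ≤ ENNReal.ofReal ((4 * (LevyType.bumpMoment d).toReal + 1) * S.toReal) :=
            ENNReal.ofReal_le_ofReal (by nlinarith [ENNReal.toReal_nonneg (a := S)])
        _ = ENNReal.ofReal (4 * (LevyType.bumpMoment d).toReal + 1) * S := by
            rw [ENNReal.ofReal_mul (by positivity), ENNReal.ofReal_toReal hS]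
    rw [mul_right_comm _ (t : ℝ≥0∞)]
    exact mul_le_mul_left h4 _
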